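/- For a real $2\times 2$ matrix $\xi$ let $0\le\lambda_1(\xi)\le\lambda_2(\xi)$ denote its singular values, i.e. the eigenvalues of $\sqrt{\xi\xi^t}$. A function $f:\mathbb R^{2\times 2}\to\mathbb R\cup\{+\infty\}$ is called rank one convex if $f(tA+(1-t)B)\le t f(A)+(1-t)f(B)$ for all $t\in[0,1]$ and all $A,B\in\mathbb R^{2\times 2}$ with $\operatorname{rank}(A-B)\le 1$; it is called polyconvex if $f(\xi)=F(\xi,\det\xi)$ for some convex $F:\mathbb R^{2\times2}\times\mathbb R\to\mathbb R\cup\{+\infty\}$. The rank one convex hull $\mathrm{Rco}\,E$ (respectively the polyconvex hull $\mathrm{Pco}\,E$) of a set $E\subseteq\mathbb R^{2\times2}$ is the set of all $\xi\in\mathbb R^{2\times 2}$ such that $f(\xi)\le 0$ for every rank one convex (respectively polyconvex) $f:\mathbb R^{2\times2}\to\mathbb R\cup\{+\infty\}$ with $f|_E\le 0$. Let $0<a_1<a_2$, $a_1\le b_1$, $a_2\le b_2$, $a_1b_1\le a_2b_2$ and $b_2\le b_1$. Let $K=\{(a_1,b_1),(a_2,b_2)\}$ and $E=\{\xi\in\mathbb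 R^{2\times2}:(\lambda_1(\xi),\lambda_2(\xi))\in K\}$. Put $$\bar\theta=\frac{a_2b_2-a_1b_1}{b_1-a_1-b_2+a_2}.$$ Then $$\mathrm{Rco}\,E=\bigl\{\xi\in\mathbb R^{2\times2}:\ \lambda_2(\xi)\le b_1,\ \ \lambda_1(\xi)\lambda_2(\xi)\le a_2b_2,\ \ \lambda_1(\xi)\lambda_2(\xi)+\bar\theta(\lambda_2(\xi)-\lambda_1(\xi))\le a_1b_1+\bar\theta(b_1-a_1)\bigr\},$$ and moreover $\mathrm{Pco}\,E=\mathrm{Rco}\,E$. -/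

import Mathlib

namespace PlanarHull

/-- The real `2 × 2` matrices. -/
abbrev Mat2 : Type := Matrix (Fin 2) (Fin 2) ℝ

/-- The smaller singular value `λ₁(ξ)` of `ξ`
(Mathlib lists singular values in decreasing order, starting with index `0`). -/
noncomputable def sv1 (ξ : Mat2) : ℝ := (Matrix.toEuclideanLin ξ).singularValues 1

/-- The larger singular value `λ₂(ξ)` of `ξ`. -/
noncomputable def sv2 (ξ : Mat2) : ℝ := (Matrix.toEuclideanLin ξ).singularValues 0

/-- The isotropic set of all matrices whose ordered pair of singular values lies in `K`. -/
def isotropicSet (K : Set (ℝ × ℝ)) : Set Mat2 := {ξ | (sv1 ξ, sv2 ξ) ∈ K}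

/-- Convexity of a function with values in `ℝ ∪ {+∞}`.
In `EReal` one has `0 * ⊤ = 0`, so that the endpoints `t = 0, 1` impose nothing. -/
def IsConvexFun {V : Type*} [AddCommGroup V] [Module ℝ V] (F : V → EReal) : Prop :=
  (∀ x, F x ≠ ⊥) ∧
    ∀ x y : V, ∀ t : ℝ, 0 ≤ t → t ≤ 1 →
      F (t • x + (1 - t) • y) ≤ (t : EReal) * F x + ((1 - t : ℝ) : EReal) * F y

/-- Rank one convexity of a function on `2 × 2` matrices with values in `ℝ ∪ {+∞}`:
convexity along segments whose direction has rank at most one. -/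
def IsRankOneConvex (f : Mat2 → EReal) : Prop :=
  (∀ ξ, f ξ ≠ ⊥) ∧
    ∀ A B : Mat2, (A - B).rank ≤ 1 → ∀ t : ℝ, 0 ≤ t → t ≤ 1 →
      f (t • A + (1 - t) • B) ≤ (t : EReal) * f A + ((1 - t : ℝ) : EReal) * f B

/-- Polyconvexity of a function on `2 × 2` matrices with values in `ℝ ∪ {+∞}`:
it is a convex function of the matrix and its determinant. -/
def IsPolyconvex (f : Mat2 → EReal) : Prop :=
  ∃ F : Mat2 × ℝ → EReal, IsConvexFun F ∧ ∀ ξ, f ξ = F (ξ, ξ.det)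

/-- The rank one convex hull. -/
def Rco (E : Set Mat2) : Set Mat2 :=
  {ξ | ∀ f : Mat2 → EReal, IsRankOneConvex f → (∀ η ∈ E, f η ≤ 0) → f ξ ≤ 0}

/-- The polyconvex hull. -/
def Pco (E : Set Mat2) : Set Mat2 :=
  {ξ | ∀ f : Mat2 → EReal, IsPolyconvex f → (∀ η ∈ E, f η ≤ 0) → f ξ ≤ 0}

end PlanarHull

namespace PlanarHull

open Matrix Module

/-! Write `ξ` as the complex map `v ↦ (z v + w v̄) / 2`. Then `λ₂ = (|z| + |w|) / 2` and `λ₁ = ||z|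
- |w|| / 2`, while `z` and `w` are linear in `ξ`, so `|z|` and `|w|` are convex.

Outer bound (`bounds_of_mem_Pco`): each inequality is a polyconvex one. `λ₂` is convex, `|det|` is
the maximum of `± det`, and the third expression is `det + θ|w|` or `-det + θ|z|` according to the
sign of the determinant. Since `θ ≤ b₂`, matrices of `E` with the other sign also obey the bound.

Inner bound (`mem_Rco_of_bounds`): the hull is invariant under orthogonal factors and decreasing in
both singular values, so only the upper boundary of the region in the `(λ₁, λ₂)` plane has to be
reached. It consists of the corner `(a₁, b₁)`, the curve `λ₁λ₂ + θ(λ₂ - λ₁) = const` swept out by a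
rank one segment between the two orbits (`diag_mem_Rco_of_affine`), and an arc of the hyperbola
`λ₁λ₂ = a₂b₂` (`diag_mem_Rco_of_mul_eq`). As `Rco E ⊆ Pco E`, both equalities follow. -/

/-! ### Singular values through the trace and the determinant. -/

theorem sv1_nonneg (ξ : Mat2) : 0 ≤ sv1 ξ := LinearMap.singularValues_nonneg _ _

theorem sv1_le_sv2 (ξ : Mat2) : sv1 ξ ≤ sv2 ξ :=
  LinearMap.singularValues_antitone _ zero_le_one

theorem adjoint_comp_self_toEuclideanLin (ξ : Mat2) :
    (toEuclideanLin ξ).adjoint ∘ₗ toEuclideanLin ξ = toLpLin 2 2 (ξᵀ * ξ) := by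
  rw [← toEuclideanLin_conjTranspose_eq_adjoint, conjTranspose_eq_transpose_of_trivial]
  ext x i
  simp

theorem sv_sq_add_sq (ξ : Mat2) : sv1 ξ ^ 2 + sv2 ξ ^ 2 = (ξᵀ * ξ).trace := by
  have hn : finrank ℝ (EuclideanSpace ℝ (Fin 2)) = 2 := by simp
  have h := ((toEuclideanLin ξ).isSymmetric_adjoint_comp_self).trace_eq_sum_eigenvalues hn
  have h2 : (toLpLin 2 2 (ξᵀ * ξ)).trace ℝ _ = (ξᵀ * ξ).trace := by
    rw [toLpLin_eq_toLin, trace_toLin_eq]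
  simp only [Fin.sum_univ_two, ← LinearMap.sq_singularValues_fin] at h
  rw [← h2, ← adjoint_comp_self_toEuclideanLin, h, sv1, sv2]
  simp [add_comm]

theorem sv_mul_sq (ξ : Mat2) : (sv1 ξ * sv2 ξ) ^ 2 = ξ.det ^ 2 := by
  have hn : finrank ℝ (EuclideanSpace ℝ (Fin 2)) = 2 := by simp
  have h := ((toEuclideanLin ξ).isSymmetric_adjoint_comp_self).det_eq_prod_eigenvalues hn
  have h2 : LinearMap.det (toLpLin 2 2 (ξᵀ * ξ)) = (ξᵀ * ξ).det :=
    LinearMap.det_toLpLin _ _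
  simp only [Fin.prod_univ_two, ← LinearMap.sq_singularValues_fin] at h
  rw [det_mul, det_transpose, ← adjoint_comp_self_toEuclideanLin] at h2
  rw [sq ξ.det, ← h2, h, sv1, sv2]
  simp
  ring

theorem trace_transpose_mul_self (ξ : Mat2) :
    (ξᵀ * ξ).trace = ξ 0 0 ^ 2 + ξ 0 1 ^ 2 + ξ 1 0 ^ 2 + ξ 1 1 ^ 2 := by
  simp [trace_fin_two, mul_apply, Fin.sum_univ_two]
  ring

theorem sv1_mul_sv2 (ξ : Mat2) : sv1 ξ * sv2 ξ = |ξ.det| := by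
  have h := (sq_eq_sq_iff_abs_eq_abs _ _).1 (sv_mul_sq ξ)
  rwa [abs_of_nonneg (mul_nonneg (sv1_nonneg ξ) ((sv1_nonneg ξ).trans (sv1_le_sv2 ξ)))] at h

/-- The singular values are determined by the determinant and the Euclidean norm. -/
theorem sv_eq_of {ξ : Mat2} {x y : ℝ} (hx : 0 ≤ x) (hxy : x ≤ y)
    (hF : x ^ 2 + y ^ 2 = (ξᵀ * ξ).trace) (hd : x * y = |ξ.det|) :
    sv1 ξ = x ∧ sv2 ξ = y := by
  have h0 := sv1_nonneg ξ
  have h1 := sv1_le_sv2 ξ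
  have h2 := sv_sq_add_sq ξ
  have h3 := sv1_mul_sv2 ξ
  have hs : sv1 ξ + sv2 ξ = x + y := by
    rw [← sq_eq_sq₀ (by linarith) (by linarith)]; linarith
  have hm : sv2 ξ - sv1 ξ = y - x := by
    rw [← sq_eq_sq₀ (by linarith) (by linarith)]; linarith
  constructor <;> linarith

/-! ### Conformal and anticonformal parts. -/

/-- Twice the conformal part of a `2 × 2` matrix, as a complex number. -/
def conformal : Mat2 →ₗ[ℝ] ℂ where
  toFun ξ := ⟨ξ 0 0 + ξ 1 1, ξ 1 0 - ξ 0 1⟩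
  map_add' ξ η := by
    apply Complex.ext <;> simp <;> ring
  map_smul' t ξ := by
    apply Complex.ext <;> simp <;> ring

/-- Twice the anticonformal part of a `2 × 2` matrix, as a complex number. -/
def anticonformal : Mat2 →ₗ[ℝ] ℂ where
  toFun ξ := ⟨ξ 0 0 - ξ 1 1, ξ 1 0 + ξ 0 1⟩
  map_add' ξ η := by
    apply Complex.ext <;> simp <;> ring
  map_smul' t ξ := by
    apply Complex.ext <;> simp <;> ring

theorem norm_conformal_sq (ξ : Mat2) :
    ‖conformal ξ‖ ^ 2 = (ξᵀ * ξ).trace + 2 * ξ.det := by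
  rw [Complex.sq_norm, Complex.normSq_apply, trace_transpose_mul_self, det_fin_two]
  simp only [conformal, LinearMap.coe_mk, AddHom.coe_mk]
  ring

theorem norm_anticonformal_sq (ξ : Mat2) :
    ‖anticonformal ξ‖ ^ 2 = (ξᵀ * ξ).trace - 2 * ξ.det := by
  rw [Complex.sq_norm, Complex.normSq_apply, trace_transpose_mul_self, det_fin_two]
  simp only [anticonformal, LinearMap.coe_mk, AddHom.coe_mk]
  ring

theorem sv_eq_norms (ξ : Mat2) :
    sv1 ξ = |‖conformal ξ‖ - ‖anticonformal ξ‖| / 2 ∧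
      sv2 ξ = (‖conformal ξ‖ + ‖anticonformal ξ‖) / 2 := by
  have hP := norm_nonneg (conformal ξ)
  have hN := norm_nonneg (anticonformal ξ)
  have h1 := norm_conformal_sq ξ
  have h2 := norm_anticonformal_sq ξ
  apply sv_eq_of
  · positivity
  · have : |‖conformal ξ‖ - ‖anticonformal ξ‖| ≤ ‖conformal ξ‖ + ‖anticonformal ξ‖ :=
      abs_sub_le_iff.2 ⟨by linarith, by linarith⟩
    linarith
  · rw [div_pow, sq_abs]; linarith
  · have h3 : ξ.det = (‖conformal ξ‖ - ‖anticonformal ξ‖) *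
        ((‖conformal ξ‖ + ‖anticonformal ξ‖) / 4) := by linarith
    rw [h3, abs_mul, abs_of_nonneg (a := (‖conformal ξ‖ + ‖anticonformal ξ‖) / 4) (by positivity)]
    ring

/-- For nonnegative determinant the conformal norm is the sum of the singular values and the
anticonformal norm their difference. -/
theorem norms_of_det_nonneg {ξ : Mat2} (h : 0 ≤ ξ.det) :
    ‖conformal ξ‖ = sv2 ξ + sv1 ξ ∧ ‖anticonformal ξ‖ = sv2 ξ - sv1 ξ := by
  obtain ⟨h1, h2⟩ := sv_eq_norms ξ
  have h3 : ‖anticonformal ξ‖ ≤ ‖conformal ξ‖ := by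
    apply le_of_sq_le_sq _ (norm_nonneg _)
    rw [norm_conformal_sq, norm_anticonformal_sq]; linarith
  rw [abs_of_nonneg (by linarith)] at h1
  constructor <;> linarith

/-- For nonpositive determinant the roles of the two norms are exchanged. -/
theorem norms_of_det_nonpos {ξ : Mat2} (h : ξ.det ≤ 0) :
    ‖conformal ξ‖ = sv2 ξ - sv1 ξ ∧ ‖anticonformal ξ‖ = sv2 ξ + sv1 ξ := by
  obtain ⟨h1, h2⟩ := sv_eq_norms ξ
  have h3 : ‖conformal ξ‖ ≤ ‖anticonformal ξ‖ := by
    apply le_of_sq_le_sq _ (norm_nonneg _)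
    rw [norm_conformal_sq, norm_anticonformal_sq]; linarith
  rw [abs_of_nonpos (by linarith)] at h1
  constructor <;> linarith

theorem sv_orthogonal_mul {U V : Mat2} (hU : Uᵀ * U = 1) (hV : V * Vᵀ = 1) (ξ : Mat2) :
    sv1 (U * ξ * V) = sv1 ξ ∧ sv2 (U * ξ * V) = sv2 ξ := by
  apply sv_eq_of (sv1_nonneg ξ) (sv1_le_sv2 ξ)
  · rw [sv_sq_add_sq]
    have : (U * ξ * V)ᵀ * (U * ξ * V) = Vᵀ * (ξᵀ * (Uᵀ * U) * ξ * V) := by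
      simp only [transpose_mul, Matrix.mul_assoc]
    rw [this, trace_mul_comm Vᵀ, hU, Matrix.mul_one, Matrix.mul_assoc (ξᵀ * ξ), hV,
      Matrix.mul_one]
  · have h1 : |U.det| = 1 := by
      have := congrArg det hU
      rw [det_mul, det_transpose, det_one] at this
      exact (abs_eq_abs.2 (mul_self_eq_one_iff.1 this)).trans abs_one
    have h2 : |V.det| = 1 := by
      have := congrArg det hV
      rw [det_mul, det_transpose, det_one] at this
      exact (abs_eq_abs.2 (mul_self_eq_one_iff.1 this)).trans abs_one
    rw [det_mul, det_mul, abs_mul, abs_mul, h1, h2, one_mul, mul_one, sv1_mul_sv2]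

/-! ### Rank one matrices and rotations. -/

theorem rank_le_one_iff_det (M : Mat2) : M.rank ≤ 1 ↔ M.det = 0 := by
  constructor
  · intro h
    by_contra hd
    have := rank_of_det_ne_zero hd
    simp at this
    omega
  · intro h
    rw [det_fin_two] at h
    suffices ∃ u v : Fin 2 → ℝ, M = vecMulVec u v by
      obtain ⟨u, v, rfl⟩ := this
      exact rank_vecMulVec_le u v
    by_cases h00 : M 0 0 = 0
    · rw [h00] at h
      rcases mul_eq_zero.1 (by linarith : M 0 1 * M 1 0 = 0) with h' | h'
      · refine ⟨![0, 1], ![M 1 0, M 1 1], ?_⟩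
        ext i j; fin_cases i <;> fin_cases j <;> simp [vecMulVec, h00, h']
      · refine ⟨![M 0 1, M 1 1], ![0, 1], ?_⟩
        ext i j; fin_cases i <;> fin_cases j <;> simp [vecMulVec, h00, h']
    · refine ⟨![1, M 1 0 / M 0 0], ![M 0 0, M 0 1], ?_⟩
      ext i j; fin_cases i <;> fin_cases j <;> simp [vecMulVec]
      · field_simp
      · field_simp; linarith

/-- The rotation matrix of angle `φ`. -/
noncomputable def rotation (φ : ℝ) : Mat2 := !![φ.cos, -φ.sin; φ.sin, φ.cos]

theorem rotation_transpose_mul (φ : ℝ) : (rotation φ)ᵀ * rotation φ = 1 := by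
  have := Real.sin_sq_add_cos_sq φ
  ext i j
  fin_cases i <;> fin_cases j <;> simp [rotation, mul_apply, Fin.sum_univ_two] <;> linarith

theorem rotation_mul_transpose (φ : ℝ) : rotation φ * (rotation φ)ᵀ = 1 :=
  mul_eq_one_comm.1 (rotation_transpose_mul φ)

/-- A singular value decomposition by rotations, the second entry carrying the sign. -/
theorem exists_rotation_decomposition (ξ : Mat2) : ∃ α β : ℝ,
    ξ = rotation α * !![(‖conformal ξ‖ + ‖anticonformal ξ‖) / 2, 0;
      0, (‖conformal ξ‖ - ‖anticonformal ξ‖) / 2] * rotation β := by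
  obtain ⟨z, hz⟩ : ∃ z, conformal ξ = z := ⟨_, rfl⟩
  obtain ⟨w, hw⟩ : ∃ w, anticonformal ξ = w := ⟨_, rfl⟩
  -- A left rotation by `α` turns both `z` and `w` by `α`; a right rotation by `β` turns `z` by `β`
  -- and `w` by `-β`. Hence `arg z = α + β` and `arg w = α - β`.
  set α := (z.arg + w.arg) / 2 with hα
  set β := (z.arg - w.arg) / 2 with hβ
  have e1 := Complex.norm_mul_cos_arg z
  have e2 := Complex.norm_mul_sin_arg z
  have e3 := Complex.norm_mul_cos_arg w
  have e4 := Complex.norm_mul_sin_arg w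
  rw [show z.arg = α + β by ring] at e1 e2
  rw [show w.arg = α - β by ring] at e3 e4
  rw [Real.cos_add] at e1
  rw [Real.sin_add] at e2
  rw [Real.cos_sub] at e3
  rw [Real.sin_sub] at e4
  have f1 : z.re = ξ 0 0 + ξ 1 1 := by rw [← hz]; rfl
  have f2 : z.im = ξ 1 0 - ξ 0 1 := by rw [← hz]; rfl
  have f3 : w.re = ξ 0 0 - ξ 1 1 := by rw [← hw]; rfl
  have f4 : w.im = ξ 1 0 + ξ 0 1 := by rw [← hw]; rfl
  refine ⟨α, β, ?_⟩
  rw [hz, hw]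
  ext i j
  fin_cases i <;> fin_cases j <;> simp [rotation, mul_apply, Fin.sum_univ_two] <;> linarith

/-! ### General properties of the two hulls. -/

theorem combination_nonpos {x y : EReal} {t : ℝ} (ht : 0 ≤ t) (ht1 : t ≤ 1) (hx : x ≤ 0)
    (hy : y ≤ 0) : (t : EReal) * x + ((1 - t : ℝ) : EReal) * y ≤ 0 := by
  have h1 : (0 : EReal) ≤ (t : EReal) := by exact_mod_cast ht
  have h2 : (0 : EReal) ≤ ((1 - t : ℝ) : EReal) := by exact_mod_cast sub_nonneg.2 ht1
  exact add_nonpos (mul_nonpos_of_nonneg_of_nonpos h1 hx) (mul_nonpos_of_nonneg_of_nonpos h2 hy)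

theorem subset_Rco (E : Set Mat2) : E ⊆ Rco E := fun ξ hξ _ _ hE => hE ξ hξ

theorem Rco_lamination {E : Set Mat2} {A B : Mat2} (hA : A ∈ Rco E) (hB : B ∈ Rco E)
    (hAB : (A - B).det = 0) {t : ℝ} (ht : 0 ≤ t) (ht1 : t ≤ 1) :
    t • A + (1 - t) • B ∈ Rco E := fun f hf hE =>
  (hf.2 A B ((rank_le_one_iff_det _).2 hAB) t ht ht1).trans
    (combination_nonpos ht ht1 (hA f hf hE) (hB f hf hE))

/-- Multiplication on either side does not raise the rank, so `η ↦ f (U * η * V)` is again rank one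
convex and can serve as a test function. -/
theorem Rco_mul_mem {E : Set Mat2} {U V : Mat2} (hUV : ∀ η ∈ E, U * η * V ∈ E) {ξ : Mat2}
    (hξ : ξ ∈ Rco E) : U * ξ * V ∈ Rco E := by
  intro f hf hE
  refine hξ (fun η => f (U * η * V)) ⟨fun η => hf.1 _, fun A B hAB t ht ht1 => ?_⟩
    fun η hη => hE _ (hUV η hη)
  have h := hf.2 (U * A * V) (U * B * V) ?_ t ht ht1
  · convert h using 2
    simp [Matrix.mul_add, Matrix.add_mul]
  · rw [← Matrix.sub_mul, ← Matrix.mul_sub]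
    exact ((rank_mul_le_left _ _).trans (rank_mul_le_right _ _)).trans hAB

theorem isRankOneConvex_of_isPolyconvex {f : Mat2 → EReal} (hf : IsPolyconvex f) :
    IsRankOneConvex f := by
  obtain ⟨F, ⟨hF, hF'⟩, hfF⟩ := hf
  refine ⟨fun ξ => hfF ξ ▸ hF _, fun A B hAB t ht ht1 => ?_⟩
  have h := hF' (A, A.det) (B, B.det) t ht ht1
  rw [hfF, hfF, hfF]
  convert h using 2
  refine Prod.ext (by simp) ?_
  · have h0 := (rank_le_one_iff_det _).1 hAB
    simp only [det_fin_two, Matrix.sub_apply, Matrix.add_apply, Matrix.smul_apply, smul_eq_mul, Prod.smul_mk,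
      Prod.mk_add_mk] at h0 ⊢
    -- The determinant is quadratic, with second order term `-t(1 - t) det (A - B)`, hence affine
    -- along rank one segments.
    linear_combination (-(t * (1 - t))) * h0

theorem Rco_subset_Pco (E : Set Mat2) : Rco E ⊆ Pco E := fun _ hξ f hf hE =>
  hξ f (isRankOneConvex_of_isPolyconvex hf) hE

/-- A bound by a nonnegative combination of the two norms plus an affine function of the
determinant passes to the polyconvex hull. -/
theorem Pco_norm_bound {E : Set Mat2} {α β γ δ : ℝ} (hα : 0 ≤ α) (hβ : 0 ≤ β)
    (hE : ∀ η ∈ E, α * ‖conformal η‖ + β * ‖anticonformal η‖ + γ * η.det ≤ δ)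
    {ξ : Mat2} (hξ : ξ ∈ Pco E) :
    α * ‖conformal ξ‖ + β * ‖anticonformal ξ‖ + γ * ξ.det ≤ δ := by
  let g : Mat2 × ℝ → ℝ := fun p =>
    α * ‖conformal p.1‖ + β * ‖anticonformal p.1‖ + γ * p.2 - δ
  have hg : IsConvexFun fun p => (g p : EReal) := by
    refine ⟨fun p => EReal.coe_ne_bot _, fun p q t ht ht1 => ?_⟩
    have key : ∀ L : Mat2 →ₗ[ℝ] ℂ,
        ‖L (t • p.1 + (1 - t) • q.1)‖ ≤ t * ‖L p.1‖ + (1 - t) * ‖L q.1‖ := fun L => by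
      rw [map_add, map_smul, map_smul]
      refine (norm_add_le _ _).trans_eq ?_
      rw [norm_smul, norm_smul, Real.norm_of_nonneg ht, Real.norm_of_nonneg (sub_nonneg.2 ht1)]
    have h1 := mul_le_mul_of_nonneg_left (key conformal) hα
    have h2 := mul_le_mul_of_nonneg_left (key anticonformal) hβ
    have : g (t • p + (1 - t) • q) ≤ t * g p + (1 - t) * g q := by
      simp only [g, Prod.fst_add, Prod.snd_add, Prod.smul_fst, Prod.smul_snd, smul_eq_mul]
      linarith
    beta_reduce
    exact_mod_cast this
  have h := hξ (fun η => (g (η, η.det) : EReal)) ⟨_, hg, fun _ => rfl⟩ fun η hη => by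
    have := hE η hη
    have : g (η, η.det) ≤ 0 := by simp only [g]; linarith
    exact_mod_cast this
  have h' : g (ξ, ξ.det) ≤ 0 := by exact_mod_cast h
  simp only [g] at h'
  linarith

/-! ### Orthogonal invariance and monotonicity for isotropic sets. -/

section Isotropic

variable {K : Set (ℝ × ℝ)}

theorem orthogonal_mul_mem_Rco {U V ξ : Mat2} (hU : Uᵀ * U = 1) (hV : V * Vᵀ = 1)
    (hξ : ξ ∈ Rco (isotropicSet K)) : U * ξ * V ∈ Rco (isotropicSet K) := by
  refine Rco_mul_mem (fun η hη => ?_) hξ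
  obtain ⟨h1, h2⟩ := sv_orthogonal_mul hU hV η
  rw [isotropicSet, Set.mem_ofPred_eq, h1, h2]
  exact hη

theorem diag_neg_mem_Rco {u v : ℝ} (h : !![u, 0; 0, v] ∈ Rco (isotropicSet K)) :
    !![u, 0; 0, -v] ∈ Rco (isotropicSet K) := by
  have := orthogonal_mul_mem_Rco (U := !![1, 0; 0, -1]) (V := 1)
    (by simp [one_fin_two, ← Matrix.ext_iff, mul_apply]) (by simp) h
  simpa using this

theorem diag_swap_mem_Rco {u v : ℝ} (h : !![u, 0; 0, v] ∈ Rco (isotropicSet K)) :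
    !![v, 0; 0, u] ∈ Rco (isotropicSet K) := by
  have := orthogonal_mul_mem_Rco (U := !![0, 1; 1, 0]) (V := !![0, 1; 1, 0])
    (by simp [one_fin_two, ← Matrix.ext_iff, mul_apply])
    (by ext i j; fin_cases i <;> fin_cases j <;> simp [mul_apply]) h
  simpa using this

/-- The matrices with last entry `v` and `-v` differ by rank one, and the segment between them
contains every intermediate entry. -/
theorem diag_mono_right_mem_Rco {u v s : ℝ} (h : !![u, 0; 0, v] ∈ Rco (isotropicSet K))
    (hs : |s| ≤ |v|) : !![u, 0; 0, s] ∈ Rco (isotropicSet K) := by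
  wlog hv : 0 ≤ v generalizing v
  · exact this (diag_neg_mem_Rco h) (by rwa [abs_neg]) (by linarith)
  rw [abs_of_nonneg hv] at hs
  rcases hv.eq_or_lt with rfl | hv
  · rwa [abs_nonpos_iff.1 hs]
  obtain ⟨h1, h2⟩ := abs_le.1 hs
  have := Rco_lamination h (diag_neg_mem_Rco h) (by simp [det_fin_two]) (t := (s + v) / (2 * v))
    (div_nonneg (by linarith) (by linarith)) (by rw [div_le_one (by linarith)]; linarith)
  convert this using 1
  ext i j
  fin_cases i <;> fin_cases j <;> simp <;> field_simp <;> ring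

theorem diag_mono_mem_Rco {u v r s : ℝ} (h : !![u, 0; 0, v] ∈ Rco (isotropicSet K))
    (hr : |r| ≤ |u|) (hs : |s| ≤ |v|) : !![r, 0; 0, s] ∈ Rco (isotropicSet K) :=
  diag_swap_mem_Rco (diag_mono_right_mem_Rco
    (diag_swap_mem_Rco (diag_mono_right_mem_Rco h hs)) hr)

/-- Reduces membership to the plane of singular values; the sign left in the rotation decomposition
does not matter, since the last diagonal entry counts only through its absolute value. -/
theorem mem_Rco_iff_diag (ξ : Mat2) : ξ ∈ Rco (isotropicSet K) ↔
    !![sv2 ξ, 0; 0, sv1 ξ] ∈ Rco (isotropicSet K) := by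
  obtain ⟨α, β, h⟩ := exists_rotation_decomposition ξ
  obtain ⟨h1, h2⟩ := sv_eq_norms ξ
  set D : Mat2 := !![(‖conformal ξ‖ + ‖anticonformal ξ‖) / 2, 0;
      0, (‖conformal ξ‖ - ‖anticonformal ξ‖) / 2] with hD
  have habs : |sv1 ξ| = |(‖conformal ξ‖ - ‖anticonformal ξ‖) / 2| := by
    rw [h1, abs_div, abs_abs, abs_div]
  trans D ∈ Rco (isotropicSet K)
  · constructor
    · intro hξ
      have := orthogonal_mul_mem_Rco (U := (rotation α)ᵀ) (V := (rotation β)ᵀ)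
        (by rw [transpose_transpose, rotation_mul_transpose])
        (by rw [transpose_transpose, rotation_transpose_mul]) hξ
      rwa [h, Matrix.mul_assoc, Matrix.mul_assoc, Matrix.mul_assoc, rotation_mul_transpose,
        Matrix.mul_one, ← Matrix.mul_assoc, rotation_transpose_mul, Matrix.one_mul] at this
    · intro hξ
      rw [h]
      exact orthogonal_mul_mem_Rco (rotation_transpose_mul α) (rotation_mul_transpose β) hξ
  · rw [h2]
    exact ⟨fun h => diag_mono_right_mem_Rco h habs.le, fun h => diag_mono_right_mem_Rco h habs.ge⟩

end Isotropic

/-! ### Rank one segments with ends in an isotropic set. -/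

theorem mem_isotropicSet_of {K : Set (ℝ × ℝ)} {ξ : Mat2} {x y : ℝ} (hK : (x, y) ∈ K)
    (hx : 0 ≤ x) (hxy : x ≤ y)
    (hF : x ^ 2 + y ^ 2 = (ξᵀ * ξ).trace) (hd : x * y = |ξ.det|) : ξ ∈ isotropicSet K := by
  obtain ⟨h1, h2⟩ := sv_eq_of hx hxy hF hd
  rw [isotropicSet, Set.mem_ofPred_eq, h1, h2]
  exact hK

theorem diag_mem_isotropicSet {K : Set (ℝ × ℝ)} {x y : ℝ} (hK : (x, y) ∈ K)
    (hx : 0 ≤ x) (hxy : x ≤ y) : !![y, 0; 0, x] ∈ isotropicSet K := by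
  apply mem_isotropicSet_of hK hx hxy
  · rw [trace_transpose_mul_self]; simp; ring
  · rw [det_fin_two]; simp [abs_of_nonneg hx, abs_of_nonneg (hx.trans hxy), mul_comm]

/-- The triangle with sides `s`, `r` and `d`. -/
theorem exists_triangle {s r d : ℝ} (hs : 0 < s) (hr : 0 ≤ r) (h1 : s - r ≤ d) (h2 : r - s ≤ d)
    (h3 : d ≤ s + r) : ∃ p q : ℝ, p ^ 2 + q ^ 2 = r ^ 2 ∧ (s - p) ^ 2 + q ^ 2 = d ^ 2 := by
  obtain ⟨p, hp⟩ : ∃ p, p * (2 * s) = s ^ 2 + r ^ 2 - d ^ 2 :=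
    ⟨(s ^ 2 + r ^ 2 - d ^ 2) / (2 * s), by field_simp⟩
  have hd : 0 ≤ d := by linarith [abs_le.2 ⟨by linarith, h1⟩, abs_nonneg (s - r)]
  have hpr : p ^ 2 ≤ r ^ 2 := by
    rw [sq_le_sq, abs_of_nonneg hr, abs_le]
    constructor
    · refine le_of_mul_le_mul_right ?_ (by linarith : 0 < 2 * s)
      rw [hp]
      nlinarith [mul_nonneg (sub_nonneg.2 h3) (by linarith : 0 ≤ s + r + d)]
    · refine le_of_mul_le_mul_right ?_ (by linarith : 0 < 2 * s)
      rw [hp]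
      nlinarith [mul_nonneg (by linarith : 0 ≤ d - (s - r)) (by linarith : 0 ≤ d + (s - r))]
  refine ⟨p, √(r ^ 2 - p ^ 2), ?_, ?_⟩ <;> rw [Real.sq_sqrt (by linarith)] <;> linarith

/-- Along a rank one segment joining `(a₁, b₁)` to `(a₂, b₂)` the product and the difference of the
singular values are affine. -/
theorem diag_mem_Rco_of_affine {K : Set (ℝ × ℝ)} {a₁ b₁ a₂ b₂ x y t : ℝ}
    (hK₁ : (a₁, b₁) ∈ K) (hK₂ : (a₂, b₂) ∈ K) (ha₁ : 0 < a₁) (ha : a₁ ≤ a₂) (hb : b₂ ≤ b₁)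
    (hT₂ : a₂ ≤ b₂) (ht : 0 ≤ t) (ht1 : t ≤ 1) (hx : 0 ≤ x)
    (hp : x * y = t * (a₁ * b₁) + (1 - t) * (a₂ * b₂))
    (hm : y - x = t * (b₁ - a₁) + (1 - t) * (b₂ - a₂)) :
    !![y, 0; 0, x] ∈ Rco (isotropicSet K) := by
  -- The three triangle inequalities amount to `a₁ ≤ a₂`, `b₂ ≤ b₁` and `0 ≤ a₁ + b₂`.
  obtain ⟨p, q, h1, h2⟩ := exists_triangle (s := (a₁ + b₁) / 2) (r := (a₂ + b₂) / 2)
    (d := (b₁ - a₁ - b₂ + a₂) / 2) (by linarith) (by linarith) (by linarith) (by linarith)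
    (by linarith)
  have hA := subset_Rco _ (diag_mem_isotropicSet hK₁ ha₁.le (by linarith))
  -- The second endpoint has `conformal` value `2(p + iq)`, of norm `a₂ + b₂`, and real
  -- `anticonformal` value `2w = b₂ - a₂`. The first endpoint's anticonformal part is real and
  -- nonnegative too, so its norm is affine along the segment; `h2` makes the difference of the
  -- endpoints singular.
  set w := (b₂ - a₂) / 2 with hw
  have hdetB : (!![p + w, -q; q, p - w] : Mat2).det = a₂ * b₂ := by
    rw [det_fin_two]; simp [hw]; linarith
  have hB : !![p + w, -q; q, p - w] ∈ Rco (isotropicSet K) := by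
    refine subset_Rco _ (mem_isotropicSet_of hK₂ (by linarith) hT₂ ?_ ?_)
    · rw [trace_transpose_mul_self]; simp [hw]; linarith
    · rw [hdetB, abs_of_nonneg]
      exact mul_nonneg (by linarith) (by linarith)
  have hM := Rco_lamination hA hB (by rw [det_fin_two]; simp [hw]; linarith) ht ht1
  have hpos : 0 ≤ y - x := by
    rw [hm]
    exact add_nonneg (mul_nonneg ht (by linarith)) (mul_nonneg (by linarith) (by linarith))
  have hdet : (t • !![b₁, 0; 0, a₁] + (1 - t) • !![p + w, -q; q, p - w] : Mat2).det = x * y := by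
    rw [hp, det_fin_two]
    simp [hw]
    linear_combination (1 - t) * h1 - t * (1 - t) * h2
  have hsv := sv_eq_of (ξ := t • !![b₁, 0; 0, a₁] + (1 - t) • !![p + w, -q; q, p - w])
    hx (sub_nonneg.1 hpos) ?_ ?_
  · rw [mem_Rco_iff_diag, hsv.1, hsv.2] at hM
    exact hM
  · have : x ^ 2 + y ^ 2 = (y - x) ^ 2 + 2 * (x * y) := by ring
    rw [this, ← hdet, hm, trace_transpose_mul_self, det_fin_two]
    simp [hw]
    ring
  · rw [hdet, abs_of_nonneg (mul_nonneg hx (by linarith))]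

/-- Shearing a diagonal matrix keeps the determinant and increases the norm. -/
theorem diag_mem_Rco_of_mul_eq {K : Set (ℝ × ℝ)} {a b x y : ℝ} (hK : (a, b) ∈ K) (ha : 0 ≤ a)
    (hab : a ≤ b) (hxy : x * y = a * b) (hF : x ^ 2 + y ^ 2 ≤ a ^ 2 + b ^ 2) :
    !![y, 0; 0, x] ∈ Rco (isotropicSet K) := by
  have key : ∀ s : ℝ, s ^ 2 = a ^ 2 + b ^ 2 - (x ^ 2 + y ^ 2) →
      !![y, s; 0, x] ∈ Rco (isotropicSet K) := fun s hs => by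
    refine subset_Rco _ (mem_isotropicSet_of hK ha hab ?_ ?_)
    · rw [trace_transpose_mul_self]; simp; linarith
    · rw [det_fin_two]; simp only [of_apply, cons_val', cons_val_zero, cons_val_fin_one,
        cons_val_one, mul_zero, sub_zero]
      rw [mul_comm y x, hxy, abs_of_nonneg (mul_nonneg ha (ha.trans hab))]
  have hs := Real.sq_sqrt (sub_nonneg.2 hF)
  have := Rco_lamination (key _ hs) (key (-√_) (by rw [neg_sq, hs])) (by simp [det_fin_two])
    (t := 1 / 2) (by norm_num) (by norm_num)
  convert this using 1
  ext i j
  fin_cases i <;> fin_cases j <;> simp <;> ring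

theorem mem_Rco_of_sv_le {K : Set (ℝ × ℝ)} {ξ : Mat2} {x y : ℝ}
    (h : !![y, 0; 0, x] ∈ Rco (isotropicSet K)) (hy : sv2 ξ ≤ y) (hx : sv1 ξ ≤ x) :
    ξ ∈ Rco (isotropicSet K) := by
  have h1 := sv1_nonneg ξ
  have h2 := sv1_le_sv2 ξ
  rw [mem_Rco_iff_diag]
  apply diag_mono_mem_Rco h
  · rw [abs_of_nonneg (by linarith), abs_of_nonneg (by linarith)]; exact hy
  · rw [abs_of_nonneg (by linarith), abs_of_nonneg (by linarith)]; exact hx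

/-! ### The two-point set: inner and outer bounds. -/

section TwoPoints

variable {a₁ b₁ a₂ b₂ θ : ℝ}

/-- After clearing the denominator, `b₂ - θ` becomes `(a₁ + b₂)(b₁ - b₂)`. -/
theorem theta_le (ha₁ : 0 < a₁) (ha : a₁ < a₂) (hb : b₂ ≤ b₁) (hT₂ : a₂ ≤ b₂)
    (hθ : θ * (b₁ - a₁ - b₂ + a₂) = a₂ * b₂ - a₁ * b₁) : θ ≤ b₂ := by
  refine le_of_mul_le_mul_right ?_ (by linarith : 0 < b₁ - a₁ - b₂ + a₂)
  rw [hθ]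
  nlinarith [mul_nonneg (by linarith : 0 ≤ a₁ + b₂) (sub_nonneg.2 hb)]

theorem mem_Rco_of_bounds (ha₁ : 0 < a₁) (ha : a₁ < a₂) (hb : b₂ ≤ b₁) (hT₁ : a₁ ≤ b₁)
    (hT₂ : a₂ ≤ b₂) (hθ : θ * (b₁ - a₁ - b₂ + a₂) = a₂ * b₂ - a₁ * b₁) (hθ0 : 0 ≤ θ) {ξ : Mat2}
    (h1 : sv2 ξ ≤ b₁) (h2 : sv1 ξ * sv2 ξ ≤ a₂ * b₂)
    (h3 : sv1 ξ * sv2 ξ + θ * (sv2 ξ - sv1 ξ) ≤ a₁ * b₁ + θ * (b₁ - a₁)) :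
    ξ ∈ Rco (isotropicSet {(a₁, b₁), (a₂, b₂)}) := by
  have hx0 := sv1_nonneg ξ
  have hxy := sv1_le_sv2 ξ
  have hθb := theta_le ha₁ ha hb hT₂ hθ
  generalize hx : sv1 ξ = x at *
  generalize hy : sv2 ξ = y at *
  have hK₁ : (a₁, b₁) ∈ ({(a₁, b₁), (a₂, b₂)} : Set (ℝ × ℝ)) := by simp
  have hK₂ : (a₂, b₂) ∈ ({(a₁, b₁), (a₂, b₂)} : Set (ℝ × ℝ)) := by simp
  rcases le_total x a₁ with hxa | hxa
  · exact mem_Rco_of_sv_le (subset_Rco _ (diag_mem_isotropicSet hK₁ ha₁.le hT₁))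
      (hy ▸ h1) (hx ▸ hxa)
  rcases le_total x a₂ with hxa₂ | hxa₂
  · have hxθ : 0 < x + θ := by linarith
    have hD : 0 < b₁ - a₁ - b₂ + a₂ := by linarith
    -- `Y` is the height over `x` of the curve where the third inequality is an equality; `hθ` says
    -- that the curve passes through both points of `K`.
    obtain ⟨Y, hY⟩ : ∃ Y, Y * (x + θ) = a₁ * b₁ + θ * (b₁ - a₁) + θ * x :=
      ⟨(a₁ * b₁ + θ * (b₁ - a₁) + θ * x) / (x + θ), by field_simp⟩
    have hyY : y ≤ Y := by
      refine le_of_mul_le_mul_right ?_ hxθ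
      linarith
    have hY₁ : Y ≤ b₁ := by
      refine le_of_mul_le_mul_right ?_ hxθ
      nlinarith [mul_nonneg (sub_nonneg.2 hxa) (by linarith : 0 ≤ b₁ - θ)]
    have hY₂ : b₂ ≤ Y := by
      refine le_of_mul_le_mul_right ?_ hxθ
      nlinarith [mul_nonneg (sub_nonneg.2 hxa₂) (sub_nonneg.2 hθb)]
    -- `t` is chosen to match the difference `Y - x`; the curve equation then forces the product to
    -- match. The bounds `b₂ ≤ Y ≤ b₁` and `a₁ ≤ x ≤ a₂` give `0 ≤ t ≤ 1`.
    obtain ⟨t, ht⟩ : ∃ t, t * (b₁ - a₁ - b₂ + a₂) = Y - x - (b₂ - a₂) :=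
      ⟨(Y - x - (b₂ - a₂)) / (b₁ - a₁ - b₂ + a₂), by field_simp⟩
    have hm := diag_mem_Rco_of_affine (x := x) (y := Y) (t := t) hK₁ hK₂ ha₁ ha.le hb hT₂
      (nonneg_of_mul_nonneg_left (by linarith) hD)
      (le_of_mul_le_mul_right (by linarith) hD) hx0
      (by linear_combination hY + θ * ht + (1 - t) * hθ) (by linarith)
    exact mem_Rco_of_sv_le hm (hy ▸ hyY) hx.le
  · have hxpos : 0 < x := by linarith
    obtain ⟨Y, hY⟩ : ∃ Y, x * Y = a₂ * b₂ := ⟨a₂ * b₂ / x, by field_simp⟩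
    have hyY : y ≤ Y := by
      refine le_of_mul_le_mul_left ?_ hxpos
      linarith
    have hYb : Y ≤ b₂ := by
      refine le_of_mul_le_mul_left ?_ hxpos
      nlinarith [mul_nonneg (sub_nonneg.2 hxa₂) (by linarith : 0 ≤ b₂)]
    refine mem_Rco_of_sv_le (diag_mem_Rco_of_mul_eq (x := x) hK₂ (by linarith) hT₂ hY ?_)
      (hy ▸ hyY) hx.le
    -- At equal products, the sum of squares is governed by the difference, here at most `b₂ - a₂`
    -- in absolute value.
    nlinarith [mul_nonneg (by linarith : 0 ≤ (b₂ - a₂) - (Y - x))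
      (by linarith : 0 ≤ (b₂ - a₂) + (Y - x))]

theorem bounds_of_mem_Pco (ha₁ : 0 < a₁) (ha : a₁ < a₂) (hab : a₁ * b₁ ≤ a₂ * b₂) (hb : b₂ ≤ b₁)
    (hT₂ : a₂ ≤ b₂) (hθ : θ * (b₁ - a₁ - b₂ + a₂) = a₂ * b₂ - a₁ * b₁) (hθ0 : 0 ≤ θ)
    {ξ : Mat2} (hξ : ξ ∈ Pco (isotropicSet {(a₁, b₁), (a₂, b₂)})) :
    sv2 ξ ≤ b₁ ∧ sv1 ξ * sv2 ξ ≤ a₂ * b₂ ∧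
      sv1 ξ * sv2 ξ + θ * (sv2 ξ - sv1 ξ) ≤ a₁ * b₁ + θ * (b₁ - a₁) := by
  have hθb := theta_le ha₁ ha hb hT₂ hθ
  have hE : ∀ η ∈ isotropicSet {(a₁, b₁), (a₂, b₂)},
      (sv1 η = a₁ ∧ sv2 η = b₁) ∨ (sv1 η = a₂ ∧ sv2 η = b₂) := fun η hη => by
    simpa [isotropicSet] using hη
  have hb₁ : sv2 ξ ≤ b₁ := by
    have := Pco_norm_bound (α := 1 / 2) (β := 1 / 2) (γ := 0) (δ := b₁) (by norm_num) (by norm_num)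
      (fun η hη => by
        have := (sv_eq_norms η).2
        rcases hE η hη with h | h <;> linarith) hξ
    rw [(sv_eq_norms ξ).2]
    linarith
  have hdet : |ξ.det| ≤ a₂ * b₂ := by
    have habs : ∀ η ∈ isotropicSet {(a₁, b₁), (a₂, b₂)}, |η.det| ≤ a₂ * b₂ := fun η hη => by
      rw [← sv1_mul_sv2]
      rcases hE η hη with ⟨h, h'⟩ | ⟨h, h'⟩ <;> rw [h, h']
      exact hab
    have h1 := Pco_norm_bound (α := 0) (β := 0) (γ := 1) (δ := a₂ * b₂) le_rfl le_rfl
      (fun η hη => by linarith [(abs_le.1 (habs η hη)).2]) hξ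
    have h2 := Pco_norm_bound (α := 0) (β := 0) (γ := -1) (δ := a₂ * b₂) le_rfl le_rfl
      (fun η hη => by linarith [(abs_le.1 (habs η hη)).1]) hξ
    exact abs_le.2 ⟨by linarith, by linarith⟩
  refine ⟨hb₁, sv1_mul_sv2 ξ ▸ hdet, ?_⟩
  have hsame : ∀ η ∈ isotropicSet {(a₁, b₁), (a₂, b₂)},
      sv1 η * sv2 η + θ * (sv2 η - sv1 η) = a₁ * b₁ + θ * (b₁ - a₁) := fun η hη => by
    rcases hE η hη with ⟨h, h'⟩ | ⟨h, h'⟩ <;> rw [h, h']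
    linarith
  -- The left side falls short of the one in `hsame` by `2 λ₁(λ₂ - θ)`, which is nonnegative because
  -- `θ ≤ b₂ ≤ λ₂` on `E`.
  have hopp : ∀ η ∈ isotropicSet {(a₁, b₁), (a₂, b₂)},
      -(sv1 η * sv2 η) + θ * (sv2 η + sv1 η) ≤ a₁ * b₁ + θ * (b₁ - a₁) := fun η hη => by
    have hle : θ ≤ sv2 η := by rcases hE η hη with h | h <;> linarith
    linarith [hsame η hη, mul_nonneg (sv1_nonneg η) (sub_nonneg.2 hle)]
  -- The test function is chosen by the sign of `det ξ`, but must be bounded on all of `E`: `hsame`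
  -- serves the matrices of that sign, `hopp` those of the other.
  rcases le_total 0 ξ.det with hd | hd
  · have := Pco_norm_bound (α := 0) (β := θ) (γ := 1) (δ := a₁ * b₁ + θ * (b₁ - a₁)) le_rfl hθ0
      (fun η hη => by
        have hm := sv1_mul_sv2 η
        rcases le_total 0 η.det with hd | hd
        · rw [abs_of_nonneg hd] at hm
          rw [(norms_of_det_nonneg hd).2]
          linarith [hsame η hη]
        · rw [abs_of_nonpos hd] at hm
          rw [(norms_of_det_nonpos hd).2]
          linarith [hopp η hη]) hξ
    rw [(norms_of_det_nonneg hd).2] at this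
    rw [sv1_mul_sv2, abs_of_nonneg hd]
    linarith
  · have := Pco_norm_bound (α := θ) (β := 0) (γ := -1) (δ := a₁ * b₁ + θ * (b₁ - a₁)) hθ0 le_rfl
      (fun η hη => by
        have hm := sv1_mul_sv2 η
        rcases le_total 0 η.det with hd | hd
        · rw [abs_of_nonneg hd] at hm
          rw [(norms_of_det_nonneg hd).1]
          linarith [hopp η hη]
        · rw [abs_of_nonpos hd] at hm
          rw [(norms_of_det_nonpos hd).1]
          linarith [hsame η hη]) hξ
    rw [(norms_of_det_nonpos hd).1] at this
    rw [sv1_mul_sv2, abs_of_nonpos hd]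
    linarith

end TwoPoints

end PlanarHull

theorem mainTheorem5 (a₁ b₁ a₂ b₂ θ : ℝ)
    (ha₁ : 0 < a₁) (ha : a₁ < a₂) (hab : a₁ * b₁ ≤ a₂ * b₂) (hb : b₂ ≤ b₁)
    (hT₁ : a₁ ≤ b₁) (hT₂ : a₂ ≤ b₂)
    (hθ : θ = (a₂ * b₂ - a₁ * b₁) / (b₁ - a₁ - b₂ + a₂)) :
    PlanarHull.Rco (PlanarHull.isotropicSet {(a₁, b₁), (a₂, b₂)}) =
        {ξ : PlanarHull.Mat2 |
          PlanarHull.sv2 ξ ≤ b₁ ∧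
          PlanarHull.sv1 ξ * PlanarHull.sv2 ξ ≤ a₂ * b₂ ∧
          PlanarHull.sv1 ξ * PlanarHull.sv2 ξ + θ * (PlanarHull.sv2 ξ - PlanarHull.sv1 ξ)
            ≤ a₁ * b₁ + θ * (b₁ - a₁)} ∧
      PlanarHull.Pco (PlanarHull.isotropicSet {(a₁, b₁), (a₂, b₂)}) =
        PlanarHull.Rco (PlanarHull.isotropicSet {(a₁, b₁), (a₂, b₂)}) := by
  have hD : 0 < b₁ - a₁ - b₂ + a₂ := by linarith
  have hθ0 : 0 ≤ θ := hθ ▸ div_nonneg (sub_nonneg.2 hab) hD.le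
  have hθ' : θ * (b₁ - a₁ - b₂ + a₂) = a₂ * b₂ - a₁ * b₁ := by
    rw [hθ, div_mul_cancel₀ _ hD.ne']
  refine ⟨Set.Subset.antisymm (fun ξ hξ => PlanarHull.bounds_of_mem_Pco ha₁ ha hab hb hT₂ hθ' hθ0
      (PlanarHull.Rco_subset_Pco _ hξ)) fun ξ hξ => PlanarHull.mem_Rco_of_bounds ha₁ ha hb hT₁ hT₂
      hθ' hθ0 hξ.1 hξ.2.1 hξ.2.2, Set.Subset.antisymm (fun ξ hξ => ?_)
      (PlanarHull.Rco_subset_Pco _)⟩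
  obtain ⟨h1, h2, h3⟩ := PlanarHull.bounds_of_mem_Pco ha₁ ha hab hb hT₂ hθ' hθ0 hξ
  exact PlanarHull.mem_Rco_of_bounds ha₁ ha hb hT₁ hT₂ hθ' hθ0 h1 h2 h3
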